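/- Let $n\geq 1$ be an integer and let $\boldsymbol{W}=\{\boldsymbol{W}_t : t\geq 0\}$ be Brownian motion in $\mathbb{R}^n$ started at the origin, that is, its $n$ coordinates are independent standard real Brownian motions. Let $\mathcal{H}_t$ denote the convex hull of $\{\boldsymbol{W}_s : 0\leq s\leq t\}$, let $R_t$ denote the circumradius of $\mathcal{H}_t$ (the radius of the smallest closed Euclidean ball that contains $\mathcal{H}_t$), and put $\Theta_1^R:=\inf\{t\geq 0 : R_t>1\}$. Then \[ \frac{1}{\log 2}\,\frac{1}{n}\;\leq\;\mathbb{E}\left[\Theta_1^R\right]\;\leq\;\frac{4}{n}. \] -/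

import Mathlib

open MeasureTheory ProbabilityTheory
open scoped NNReal ENNReal

namespace BrownianHull

/-- `W` is a Brownian motion in `ℝⁿ` starting at the origin, on the probability space `(Ω, P)`: each
coordinate is a standard real Brownian motion (started at `0`, with almost surely continuous
paths), and the `n` coordinate processes are independent. -/
structure IsBrownianMotion {Ω : Type*} [MeasurableSpace Ω] {n : ℕ}
    (W : ℝ≥0 → Ω → EuclideanSpace ℝ (Fin n)) (P : Measure Ω) : Prop where
  coord : ∀ j : Fin n, IsBrownianReal (fun t ω => W t ω j) P
  indep : iIndepFun (fun (j : Fin n) (ω : Ω) (t : ℝ≥0) => W t ω j) P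

/-- The convex hull of the path of `W` run up to time `t`. -/
def hull {Ω : Type*} {n : ℕ} (W : ℝ≥0 → Ω → EuclideanSpace ℝ (Fin n)) (t : ℝ≥0) (ω : Ω) :
    Set (EuclideanSpace ℝ (Fin n)) :=
  convexHull ℝ {x | ∃ s : ℝ≥0, s ≤ t ∧ W s ω = x}

/-- The circumradius of a set in `ℝⁿ`: the infimum of the radii of the closed Euclidean balls that
contain it (`∞` if the set is unbounded). -/
noncomputable def circumradius {n : ℕ} (K : Set (EuclideanSpace ℝ (Fin n))) : ℝ≥0∞ :=
  ⨅ (p : EuclideanSpace ℝ (Fin n)) (r : ℝ≥0) (_ : K ⊆ Metric.closedBall p (r : ℝ)), (r : ℝ≥0∞)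

/-- The inverse circumradius process `Θ_y = inf {t ≥ 0 : R_t > y}`, where `R_t` is the circumradius
of the hull at time `t` (the infimum of the empty set is `∞`). -/
noncomputable def inverseCircumradius {Ω : Type*} {n : ℕ}
    (W : ℝ≥0 → Ω → EuclideanSpace ℝ (Fin n)) (y : ℝ≥0) (ω : Ω) : ℝ≥0∞ :=
  ⨅ (t : ℝ≥0) (_ : (y : ℝ≥0∞) < circumradius (hull W t ω)), (t : ℝ≥0∞)

end BrownianHull

namespace BrownianHull

/-! Both bounds rest on the martingale `‖x‖ ^ 2 - n * t`, applied to the random walk that W traces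
on a grid of mesh h and then passed to the limit h → 0.

Upper bound. The hull contains the origin and has diameter at most twice its circumradius, so the
path cannot leave the ball of radius 2 about 0 while the circumradius is at most 1. The expected
exit time of that ball is 4 / n. On the grid the overshoot at the exit is controlled by fourth
moments (`sum_measureReal_stays_le`), and Fatou's lemma gives the limit.

Lower bound. Three balls of radii s/2, 3s/4, s are used in turn. When the path leaves the current
ball, the centre moves by s/4 towards the exit point; the next ball then contains the previous one
and hence the whole path so far. Until the last ball is left the circumradius is at most s. The
three stages start at distances 0, s/4, s/2 from their centres, so their expected lengths add up to
(1/4 + 1/2 + 3/4) s² / n = (3/2) s² / n. Since 3/2 > 1 / log 2, taking s = 99/100 and a long finite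
horizon still leaves room (`le_sum_measureReal_inside'`, `circumradius_hull_le_one_of_mem_inside`,
reverse Fatou). -/

/-- A sequence of random vectors whose coordinates are all independent, centred Gaussian with
variance `h`: the increments of a Brownian motion along a grid of mesh `h`. -/
structure IsGaussianStep {Ω : Type*} [MeasurableSpace Ω] {n : ℕ}
    (ξ : ℕ → Ω → EuclideanSpace ℝ (Fin n)) (h : ℝ≥0) (P : Measure Ω) : Prop where
  measurable : ∀ k, Measurable (ξ k)
  indep : iIndepFun (fun (p : Fin n × ℕ) (ω : Ω) => ξ p.2 ω p.1) P
  law : ∀ k j, HasLaw (fun ω => ξ k ω j) (gaussianReal 0 h) P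

/-- The `σ`-algebra generated by the first `k` terms of a sequence of random vectors. -/
@[reducible] def past {Ω : Type*} {n : ℕ} (ξ : ℕ → Ω → EuclideanSpace ℝ (Fin n)) (k : ℕ) :
    MeasurableSpace Ω :=
  ⨆ p ∈ {p : Fin n × ℕ | p.2 < k}, MeasurableSpace.comap (fun ω => ξ p.2 ω p.1) inferInstance

/-! ### Gaussian steps: filtration, moments and the one-step martingale identity. -/

section Steps

lemma past_mono {Ω : Type*} {n : ℕ} (ξ : ℕ → Ω → EuclideanSpace ℝ (Fin n)) : Monotone (past ξ) := by
  intro k l hkl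
  exact biSup_mono fun p hp => lt_of_lt_of_le hp hkl

lemma measurable_past_succ {Ω : Type*} {n : ℕ} (ξ : ℕ → Ω → EuclideanSpace ℝ (Fin n)) (k : ℕ) :
    Measurable[past ξ (k + 1)] (ξ k) := by
  have hcoord : ∀ j, Measurable[past ξ (k + 1)] (fun ω => ξ k ω j) := by
    intro j
    have hle : MeasurableSpace.comap (fun ω => ξ k ω j) inferInstance ≤ past ξ (k + 1) :=
      le_iSup₂_of_le (f := fun (p : Fin n × ℕ) (_ : p ∈ {p : Fin n × ℕ | p.2 < k + 1}) =>
        MeasurableSpace.comap (fun ω => ξ p.2 ω p.1) inferInstance) (j, k) (Nat.lt_succ_self k)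
        le_rfl
    exact (comap_measurable (fun ω => ξ k ω j)).mono hle le_rfl
  have h2 := @measurable_pi_lambda Ω (Fin n) (fun _ => ℝ) (past ξ (k + 1)) _
    (fun ω j => ξ k ω j) hcoord
  exact (MeasurableEquiv.toLp 2 (Fin n → ℝ)).measurable.comp h2

variable {Ω : Type*} [mΩ : MeasurableSpace Ω] {n : ℕ} {ξ : ℕ → Ω → EuclideanSpace ℝ (Fin n)}
  {h : ℝ≥0} {P : Measure Ω}

namespace IsGaussianStep

lemma measurable_coord (hξ : IsGaussianStep ξ h P) (k : ℕ) (j : Fin n) :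
    Measurable (fun ω => ξ k ω j) := by
  have := hξ.measurable k
  fun_prop

lemma past_le (hξ : IsGaussianStep ξ h P) (k : ℕ) : past ξ k ≤ mΩ :=
  iSup₂_le fun p _ => (hξ.measurable_coord p.2 p.1).comap_le

lemma indep_past (hξ : IsGaussianStep ξ h P) (k : ℕ) (j : Fin n) :
    Indep (past ξ k) (MeasurableSpace.comap (fun ω => ξ k ω j) inferInstance) P := by
  have h1 := indep_iSup_of_disjoint
    (m := fun p : Fin n × ℕ => MeasurableSpace.comap (fun ω => ξ p.2 ω p.1) inferInstance)
    (fun p => (hξ.measurable_coord p.2 p.1).comap_le) hξ.indep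
    (S := {p : Fin n × ℕ | p.2 < k}) (T := {(j, k)}) (by
      rw [Set.disjoint_singleton_right]; simp)
  simpa [past] using h1

lemma isProbabilityMeasure (hξ : IsGaussianStep ξ h P) : IsProbabilityMeasure P :=
  hξ.indep.isProbabilityMeasure

lemma integral_coord (hξ : IsGaussianStep ξ h P) (k : ℕ) (j : Fin n) :
    ∫ ω, ξ k ω j ∂P = 0 := by
  rw [(hξ.law k j).integral_eq, integral_id_gaussianReal]

lemma memLp_coord (hξ : IsGaussianStep ξ h P) (k : ℕ) (j : Fin n) (p : ℝ≥0∞) (hp : p ≠ ∞) :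
    MemLp (fun ω => ξ k ω j) p P :=
  (hξ.law k j).hasGaussianLaw.memLp hp

lemma integral_coord_sq (hξ : IsGaussianStep ξ h P) (k : ℕ) (j : Fin n) :
    ∫ ω, (ξ k ω j) ^ 2 ∂P = h := by
  have h1 := (hξ.law k j).variance_eq
  rw [variance_id_gaussianReal] at h1
  rw [← h1, variance_of_integral_eq_zero (hξ.measurable_coord k j).aemeasurable
    (hξ.integral_coord k j)]

lemma integrable_coord_pow (hξ : IsGaussianStep ξ h P) (k : ℕ) (j : Fin n) (a : ℕ) :
    Integrable (fun ω => (ξ k ω j) ^ a) P := by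
  have := hξ.isProbabilityMeasure
  refine ((hξ.memLp_coord k j a (by simp)).integrable_norm_pow').mono'
    ((hξ.measurable_coord k j).pow_const a).aestronglyMeasurable ?_
  filter_upwards with ω
  rw [norm_pow]

/-- Gaussian scaling. Only the factor h² matters later, so the standard fourth moment is left
unevaluated. -/
lemma integral_coord_pow_four (hξ : IsGaussianStep ξ h P) (k : ℕ) (j : Fin n) :
    ∫ ω, (ξ k ω j) ^ 4 ∂P = (h : ℝ) ^ 2 * ∫ x, x ^ 4 ∂(gaussianReal 0 1) := by
  have h0 : gaussianReal 0 h = (gaussianReal 0 1).map (fun x => Real.sqrt h * x) := by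
    rw [gaussianReal_map_const_mul]
    congr 1
    · simp
    · ext; simp
  have h1 := (hξ.law k j).integral_comp (f := fun x : ℝ => x ^ 4) (by fun_prop)
  simp only [Function.comp_def] at h1
  rw [h1, h0, integral_map (by fun_prop) (by fun_prop), ← integral_const_mul]
  congr 1
  ext x
  rw [mul_pow]
  congr 1
  rw [show (4 : ℕ) = 2 * 2 from rfl, pow_mul, Real.sq_sqrt h.coe_nonneg]

lemma norm_sq_eq_sum (x : EuclideanSpace ℝ (Fin n)) : ‖x‖ ^ 2 = ∑ j, x j ^ 2 := by
  rw [EuclideanSpace.norm_sq_eq]; simp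

lemma integrable_norm_sq (hξ : IsGaussianStep ξ h P) (k : ℕ) :
    Integrable (fun ω => ‖ξ k ω‖ ^ 2) P := by
  simp_rw [norm_sq_eq_sum]
  exact integrable_finsetSum _ fun j _ => hξ.integrable_coord_pow k j 2

lemma integrable (hξ : IsGaussianStep ξ h P) (k : ℕ) : Integrable (ξ k) P := by
  have := hξ.isProbabilityMeasure
  have h2 : MemLp (ξ k) 2 P := by
    rw [memLp_two_iff_integrable_sq_norm (hξ.measurable k).aestronglyMeasurable]
    exact hξ.integrable_norm_sq k
  exact h2.integrable (by norm_num)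

lemma norm_pow_four_le (x : EuclideanSpace ℝ (Fin n)) : ‖x‖ ^ 4 ≤ n * ∑ j, x j ^ 4 := by
  have h1 := sq_sum_le_card_mul_sum_sq (s := Finset.univ) (f := fun j => x j ^ 2)
  rw [show (4 : ℕ) = 2 * 2 from rfl, pow_mul, norm_sq_eq_sum]
  simp_rw [pow_mul]
  simpa using h1

lemma integrable_norm_pow_four (hξ : IsGaussianStep ξ h P) (k : ℕ) :
    Integrable (fun ω => ‖ξ k ω‖ ^ 4) P := by
  refine ((integrable_finsetSum Finset.univ fun j _ =>
    hξ.integrable_coord_pow k j 4).const_mul (n : ℝ)).mono'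
    ((hξ.measurable k).norm.pow_const 4).aestronglyMeasurable ?_
  filter_upwards with ω
  rw [Real.norm_of_nonneg (by positivity)]
  exact norm_pow_four_le _

lemma integral_norm_pow_four_le (hξ : IsGaussianStep ξ h P) (k : ℕ) :
    ∫ ω, ‖ξ k ω‖ ^ 4 ∂P ≤ (n : ℝ) ^ 2 * (∫ x, x ^ 4 ∂(gaussianReal 0 1)) * (h : ℝ) ^ 2 := by
  have hi := fun j => hξ.integrable_coord_pow k j 4
  calc ∫ ω, ‖ξ k ω‖ ^ 4 ∂P ≤ ∫ ω, n * ∑ j, (ξ k ω j) ^ 4 ∂P :=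
        integral_mono (hξ.integrable_norm_pow_four k)
          ((integrable_finsetSum Finset.univ fun j _ => hi j).const_mul _)
          fun ω => norm_pow_four_le _
    _ = _ := by
        rw [integral_const_mul, integral_finsetSum _ fun j _ => hi j]
        simp_rw [hξ.integral_coord_pow_four k]
        simp
        ring

/-- The expected change of `‖x‖ ^ 2` over one step, on an event `A` of the past. -/
lemma integral_indicator_step (hξ : IsGaussianStep ξ h P) (k : ℕ) {A : Set Ω}
    (hA : MeasurableSet[past ξ k] A) {u : Ω → EuclideanSpace ℝ (Fin n)}
    (hu : Measurable[past ξ k] u) (hui : Integrable u P) :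
    Integrable (fun ω => 2 * inner ℝ (u ω) (ξ k ω) + A.indicator 1 ω * ‖ξ k ω‖ ^ 2) P ∧
    ∫ ω, 2 * inner ℝ (u ω) (ξ k ω) + A.indicator 1 ω * ‖ξ k ω‖ ^ 2 ∂P = P.real A * (n * h) := by
  have := hξ.isProbabilityMeasure
  have hAm : MeasurableSet A := hξ.past_le k _ hA
  have huj : ∀ j, Measurable[past ξ k] (fun ω => u ω j) := fun j =>
    (by fun_prop : Measurable (fun x : EuclideanSpace ℝ (Fin n) => x j)).comp hu
  have huji : ∀ j, Integrable (fun ω => u ω j) P := fun j => by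
    refine hui.mono ((huj j).mono (hξ.past_le k) le_rfl).aestronglyMeasurable ?_
    filter_upwards with ω
    exact PiLp.norm_apply_le _ _
  have hind1 : ∀ j, IndepFun (fun ω => u ω j) (fun ω => ξ k ω j) P := fun j =>
    indep_of_indep_of_le_left (hξ.indep_past k j) (huj j).comap_le
  have hAi : Measurable[past ξ k] (A.indicator (1 : Ω → ℝ)) := by
    have h1 : Measurable[past ξ k] (1 : Ω → ℝ) := measurable_const
    exact h1.indicator hA
  have hind2 : ∀ j, IndepFun (A.indicator (1 : Ω → ℝ)) (fun ω => (ξ k ω j) ^ 2) P := fun j => by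
    have h1 : IndepFun (A.indicator (1 : Ω → ℝ)) (fun ω => ξ k ω j) P :=
      indep_of_indep_of_le_left (hξ.indep_past k j) hAi.comap_le
    exact h1.comp measurable_id (measurable_id.pow_const 2)
  have hAint : Integrable (A.indicator (1 : Ω → ℝ)) P :=
    (integrable_const (1 : ℝ)).indicator hAm
  have e : ∀ ω, 2 * inner ℝ (u ω) (ξ k ω) + A.indicator 1 ω * ‖ξ k ω‖ ^ 2
      = ∑ j, (2 * (u ω j * ξ k ω j) + A.indicator 1 ω * (ξ k ω j) ^ 2) := by
    intro ω
    rw [Finset.sum_add_distrib, ← Finset.mul_sum, ← Finset.mul_sum, norm_sq_eq_sum]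
    congr 2
    simp [PiLp.inner_apply, mul_comm]
  have i1 : ∀ j, Integrable (fun ω => 2 * (u ω j * ξ k ω j)) P := fun j =>
    ((hind1 j).integrable_mul (huji j) (by simpa using hξ.integrable_coord_pow k j 1)).const_mul 2
  have i2 : ∀ j, Integrable (fun ω => A.indicator (1 : Ω → ℝ) ω * (ξ k ω j) ^ 2) P := fun j =>
    (hind2 j).integrable_mul hAint (hξ.integrable_coord_pow k j 2)
  have i3 : ∀ j, Integrable
      (fun ω => 2 * (u ω j * ξ k ω j) + A.indicator 1 ω * (ξ k ω j) ^ 2) P := fun j =>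
    (i1 j).add (i2 j)
  simp_rw [e]
  refine ⟨integrable_finsetSum _ fun j _ => i3 j, ?_⟩
  rw [integral_finsetSum _ fun j _ => i3 j]
  have e2 : ∀ j, ∫ ω, 2 * (u ω j * ξ k ω j) + A.indicator 1 ω * (ξ k ω j) ^ 2 ∂P
      = P.real A * h := by
    intro j
    rw [integral_add (i1 j) (i2 j), integral_const_mul,
      (hind1 j).integral_fun_mul_eq_mul_integral (huji j).aestronglyMeasurable
        (hξ.measurable_coord k j).aestronglyMeasurable,
      (hind2 j).integral_fun_mul_eq_mul_integral hAint.aestronglyMeasurable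
        ((hξ.measurable_coord k j).pow_const 2).aestronglyMeasurable,
      hξ.integral_coord, hξ.integral_coord_sq, integral_indicator_one hAm]
    ring
  simp_rw [e2]
  simp
  ring

lemma integral_sum_indicator_step (hξ : IsGaussianStep ξ h P) (K : ℕ) {A : ℕ → Set Ω}
    (hA : ∀ k, MeasurableSet[past ξ k] (A k)) {u : ℕ → Ω → EuclideanSpace ℝ (Fin n)}
    (hu : ∀ k, Measurable[past ξ k] (u k)) (hui : ∀ k, Integrable (u k) P) :
    Integrable (fun ω => ∑ k ∈ Finset.range K,
      (2 * inner ℝ (u k ω) (ξ k ω) + (A k).indicator 1 ω * ‖ξ k ω‖ ^ 2)) P ∧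
    ∫ ω, ∑ k ∈ Finset.range K,
      (2 * inner ℝ (u k ω) (ξ k ω) + (A k).indicator 1 ω * ‖ξ k ω‖ ^ 2) ∂P
      = n * h * ∑ k ∈ Finset.range K, P.real (A k) := by
  have hk := fun k => hξ.integral_indicator_step k (hA k) (hu k) (hui k)
  refine ⟨integrable_finsetSum _ fun k _ => (hk k).1, ?_⟩
  rw [integral_finsetSum _ fun k _ => (hk k).1, Finset.mul_sum]
  refine Finset.sum_congr rfl fun k _ => ?_
  rw [(hk k).2, mul_comm]

end IsGaussianStep

end Steps

/-! ### Exit of the walk from the ball of radius 2. -/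

section Walk

variable {Ω : Type*} [mΩ : MeasurableSpace Ω] {n : ℕ} {ξ : ℕ → Ω → EuclideanSpace ℝ (Fin n)}
  {h : ℝ≥0} {P : Measure Ω}

/-- The random walk with steps `ξ`. -/
def walk {Ω : Type*} {n : ℕ} (ξ : ℕ → Ω → EuclideanSpace ℝ (Fin n)) (k : ℕ) (ω : Ω) :
    EuclideanSpace ℝ (Fin n) :=
  ∑ i ∈ Finset.range k, ξ i ω

lemma measurable_past_walk {Ω : Type*} {n : ℕ} (ξ : ℕ → Ω → EuclideanSpace ℝ (Fin n)) (k : ℕ) :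
    Measurable[past ξ k] (walk ξ k) := by
  unfold walk
  refine Finset.measurable_fun_sum _ fun i hi => ?_
  exact (measurable_past_succ ξ i).mono
    (past_mono ξ (Nat.succ_le_of_lt (Finset.mem_range.1 hi))) le_rfl

/-- The event that the walk stays in the closed ball of radius `r` up to step `k`. -/
def stays {Ω : Type*} {n : ℕ} (ξ : ℕ → Ω → EuclideanSpace ℝ (Fin n)) (r : ℝ) (k : ℕ) : Set Ω :=
  {ω | ∀ j ≤ k, ‖walk ξ j ω‖ ≤ r}

lemma measurableSet_stays {Ω : Type*} {n : ℕ} (ξ : ℕ → Ω → EuclideanSpace ℝ (Fin n)) (r : ℝ)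
    (k : ℕ) : MeasurableSet[past ξ k] (stays ξ r k) := by
  have : stays ξ r k = ⋂ j ≤ k, {ω | ‖walk ξ j ω‖ ≤ r} := by ext; simp [stays]
  rw [this]
  refine MeasurableSet.iInter fun j => MeasurableSet.iInter fun hj => ?_
  exact (measurable_norm.comp ((measurable_past_walk ξ j).mono (past_mono ξ hj) le_rfl))
    measurableSet_Iic

/-- Here z is the length of the exiting step. Steps shorter than ε cost only ε; longer ones are
dominated by z⁴, whose expectation is of order h² and so negligible even when summed over the grid.
-/
lemma add_sq_le_add_pow_four {ε z : ℝ} (hε : 0 < ε) (hz : 0 ≤ z) :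
    (2 + z) ^ 2 ≤ (2 + ε) ^ 2 + (4 / ε ^ 3 + 1 / ε ^ 2) * z ^ 4 := by
  rcases le_total z ε with hle | hle
  · have : 0 ≤ (4 / ε ^ 3 + 1 / ε ^ 2) * z ^ 4 := by positivity
    nlinarith
  · have h1 : 4 * z ≤ 4 / ε ^ 3 * z ^ 4 := by
      rw [div_mul_eq_mul_div, le_div_iff₀ (by positivity)]
      have : ε ^ 3 ≤ z ^ 3 := by gcongr
      nlinarith [mul_le_mul_of_nonneg_left this hz]
    have h2 : z ^ 2 ≤ 1 / ε ^ 2 * z ^ 4 := by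
      rw [div_mul_eq_mul_div, le_div_iff₀ (by positivity)]
      have : ε ^ 2 ≤ z ^ 2 := by gcongr
      nlinarith [mul_le_mul_of_nonneg_left this (sq_nonneg z)]
    nlinarith

lemma norm_add_sq_eq {n : ℕ} (x v : EuclideanSpace ℝ (Fin n)) :
    ‖x + v‖ ^ 2 = ‖x‖ ^ 2 + (2 * inner ℝ x v + ‖v‖ ^ 2) := by
  rw [norm_add_sq_real]; ring

/-- The left side telescopes to the squared norm of the walk stopped at K or at its first exit,
whichever comes first. The index of the exiting step is not known, so all fourth powers are added.
-/
lemma sum_stays_le {Ω : Type*} (ξ : ℕ → Ω → EuclideanSpace ℝ (Fin n)) {ε : ℝ} (hε : 0 < ε) (K : ℕ) (ω : Ω) :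
    ∑ k ∈ Finset.range K, (2 * inner ℝ ((stays ξ 2 k).indicator (walk ξ k) ω) (ξ k ω) +
      (stays ξ 2 k).indicator 1 ω * ‖ξ k ω‖ ^ 2) ≤
    (2 + ε) ^ 2 + (4 / ε ^ 3 + 1 / ε ^ 2) * ∑ k ∈ Finset.range K, ‖ξ k ω‖ ^ 4 := by
  set C := 4 / ε ^ 3 + 1 / ε ^ 2 with hC
  have hC0 : 0 ≤ C := by positivity
  -- Strengthened for induction: while the walk stays inside, the sum equals its squared norm
  -- exactly, and the extra term stores the unused allowance.
  suffices H : ∑ k ∈ Finset.range K, (2 * inner ℝ ((stays ξ 2 k).indicator (walk ξ k) ω) (ξ k ω) +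
      (stays ξ 2 k).indicator 1 ω * ‖ξ k ω‖ ^ 2) +
      (stays ξ 2 K).indicator (fun ω => (2 + ε) ^ 2 - ‖walk ξ K ω‖ ^ 2) ω ≤
    (2 + ε) ^ 2 + C * ∑ k ∈ Finset.range K, ‖ξ k ω‖ ^ 4 by
    have : 0 ≤ (stays ξ 2 K).indicator (fun ω => (2 + ε) ^ 2 - ‖walk ξ K ω‖ ^ 2) ω := by
      refine Set.indicator_nonneg (fun ω hω => ?_) ω
      have := hω K le_rfl
      nlinarith [norm_nonneg (walk ξ K ω)]
    linarith
  induction K with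
  | zero => simp [walk, stays]
  | succ K ih =>
    rw [Finset.sum_range_succ, Finset.sum_range_succ]
    have hw : walk ξ (K + 1) ω = walk ξ K ω + ξ K ω := by simp [walk, Finset.sum_range_succ]
    by_cases h1 : ω ∈ stays ξ 2 K
    · have h2 : ‖walk ξ (K + 1) ω‖ ^ 2 ≤ (2 + ε) ^ 2 + C * ‖ξ K ω‖ ^ 4 := by
        rw [hw]
        refine le_trans ?_ (add_sq_le_add_pow_four hε (norm_nonneg _))
        gcongr
        exact (norm_add_le _ _).trans (by gcongr; exact h1 K le_rfl)
      have h3 := norm_add_sq_eq (walk ξ K ω) (ξ K ω)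
      rw [← hw] at h3
      have h4 : (stays ξ 2 (K + 1)).indicator (fun ω => (2 + ε) ^ 2 - ‖walk ξ (K + 1) ω‖ ^ 2) ω ≤
          (2 + ε) ^ 2 - ‖walk ξ (K + 1) ω‖ ^ 2 + C * ‖ξ K ω‖ ^ 4 := by
        by_cases h5 : ω ∈ stays ξ 2 (K + 1)
        · rw [Set.indicator_of_mem h5]
          have : 0 ≤ C * ‖ξ K ω‖ ^ 4 := by positivity
          linarith
        · rw [Set.indicator_of_notMem h5]
          linarith
      simp only [Set.indicator_of_mem h1, Pi.one_apply] at ih ⊢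
      linarith
    · have h5 : ω ∉ stays ξ 2 (K + 1) := fun hc => h1 fun j hj => hc j (by omega)
      simp only [Set.indicator_of_notMem h1, Set.indicator_of_notMem h5, inner_zero_left] at ih ⊢
      have : 0 ≤ C * ‖ξ K ω‖ ^ 4 := by positivity
      linarith

namespace IsGaussianStep

lemma integrable_walk (hξ : IsGaussianStep ξ h P) (k : ℕ) : Integrable (walk ξ k) P :=
  integrable_finsetSum _ fun i _ => hξ.integrable i

lemma sum_measureReal_stays_le (hξ : IsGaussianStep ξ h P) {ε : ℝ} (hε : 0 < ε) (K : ℕ) :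
    n * h * ∑ k ∈ Finset.range K, P.real (stays ξ 2 k) ≤
      (2 + ε) ^ 2 + (4 / ε ^ 3 + 1 / ε ^ 2) *
        (n ^ 2 * (∫ x, x ^ 4 ∂(gaussianReal 0 1))) * (K * h ^ 2) := by
  have := hξ.isProbabilityMeasure
  obtain ⟨h1, h2⟩ := hξ.integral_sum_indicator_step K (A := stays ξ 2)
    (u := fun k => (stays ξ 2 k).indicator (walk ξ k)) (measurableSet_stays ξ 2)
    (fun k => (measurable_past_walk ξ k).indicator (measurableSet_stays ξ 2 k))
    (fun k => (hξ.integrable_walk k).indicator (hξ.past_le k _ (measurableSet_stays ξ 2 k)))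
  have h3 : Integrable (fun ω => ∑ k ∈ Finset.range K, ‖ξ k ω‖ ^ 4) P :=
    integrable_finsetSum _ fun k _ => hξ.integrable_norm_pow_four k
  rw [← h2]
  refine (integral_mono h1 ((integrable_const _).add (h3.const_mul _))
    (sum_stays_le ξ hε K)).trans ?_
  simp only [Pi.add_apply]
  rw [integral_add (integrable_const _) (h3.const_mul _), integral_const_mul,
    integral_finsetSum _ fun k _ => hξ.integrable_norm_pow_four k]
  simp only [integral_const, probReal_univ, one_smul]
  rw [mul_assoc]
  gcongr
  calc ∑ k ∈ Finset.range K, ∫ ω, ‖ξ k ω‖ ^ 4 ∂P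
      ≤ ∑ _k ∈ Finset.range K, (n : ℝ) ^ 2 * (∫ x, x ^ 4 ∂(gaussianReal 0 1)) * (h : ℝ) ^ 2 :=
        Finset.sum_le_sum fun k _ => hξ.integral_norm_pow_four_le k
    _ = _ := by simp; ring

end IsGaussianStep

end Walk

/-! ### The chain of three nested balls. -/

section NestedBalls

/-- The radii of three nested balls, the largest one being of radius `s`. -/
noncomputable def radius (s : ℝ) (i : ℕ) : ℝ := s * (2 + i) / 4

variable {n : ℕ}

/-- One step of the chain of states `(i, c, x)`: the point `x` moves by `v`, and if it leaves the
`i`-th ball around `c`, then `c` is moved towards `x` to become the centre of the next ball. -/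
noncomputable def nestedStep (s : ℝ) (z : ℕ × EuclideanSpace ℝ (Fin n) × EuclideanSpace ℝ (Fin n))
    (v : EuclideanSpace ℝ (Fin n)) : ℕ × EuclideanSpace ℝ (Fin n) × EuclideanSpace ℝ (Fin n) :=
  if z.1 < 3 ∧ radius s z.1 ≤ ‖z.2.2 + v - z.2.1‖ then
    -- At distance exactly `radius s i` this fraction is a shift by s/4, the difference of
    -- consecutive radii, so the new ball contains the old one and is internally tangent to it.
    (z.1 + 1, z.2.1 + (2 + (z.1 : ℝ))⁻¹ • (z.2.2 + v - z.2.1), z.2.2 + v)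
  else (z.1, z.2.1, z.2.2 + v)

/-- The chain with transitions `nestedStep`, driven by the steps `v`. -/
noncomputable def nestedChain (s : ℝ) (v : ℕ → EuclideanSpace ℝ (Fin n)) :
    ℕ → ℕ × EuclideanSpace ℝ (Fin n) × EuclideanSpace ℝ (Fin n)
  | 0 => (0, 0, 0)
  | k + 1 => nestedStep s (nestedChain s v k) (v k)

/-- A lower bound for the expected time to leave the last of the nested balls. -/
noncomputable def potential (s : ℝ)
    (z : ℕ × EuclideanSpace ℝ (Fin n) × EuclideanSpace ℝ (Fin n)) : ℝ :=
  -- This is n times the expected time left: the constant is the squared current radius plus the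
  -- later stages' gains, which in units of s²/16 are 4, 8, 12 for i = 0, 1, 2. Hence 24, 21, 16.
  if z.1 < 3 then s ^ 2 * (24 - z.1 ^ 2 - 2 * z.1) / 16 - ‖z.2.2 - z.2.1‖ ^ 2 else 0

lemma radius_nonneg {s : ℝ} (hs : 0 ≤ s) (i : ℕ) : 0 ≤ radius s i := by
  unfold radius; positivity

lemma potential_of_lt (s : ℝ)
    {z : ℕ × EuclideanSpace ℝ (Fin n) × EuclideanSpace ℝ (Fin n)} (hz : z.1 < 3) :
    potential s z = s ^ 2 * (24 - z.1 ^ 2 - 2 * z.1) / 16 - ‖z.2.2 - z.2.1‖ ^ 2 :=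
  if_pos hz

lemma potential_of_not_lt (s : ℝ)
    {z : ℕ × EuclideanSpace ℝ (Fin n) × EuclideanSpace ℝ (Fin n)} (hz : ¬ z.1 < 3) :
    potential s z = 0 :=
  if_neg hz

lemma sub_nestedStep_center (c x : EuclideanSpace ℝ (Fin n)) (l : ℝ) :
    x - (c + l • (x - c)) = (1 - l) • (x - c) := by
  module

/-- Equality holds without a change of ball. At a change with y = x + v - c, the potential gains
(2i+3)/(2+i)² ‖y‖² from recentring and loses s² (2i+3)/16 in the constant; the two balance at ‖y‖ =
`radius s i`, so overshoot only helps. At the last exit s² - ‖y‖² ≤ 0. -/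
lemma potential_sub_le {s : ℝ} (hs : 0 ≤ s)
    (z : ℕ × EuclideanSpace ℝ (Fin n) × EuclideanSpace ℝ (Fin n)) (v : EuclideanSpace ℝ (Fin n))
    (hz : z.1 < 3) :
    potential s z - (2 * inner ℝ (z.2.2 - z.2.1) v + ‖v‖ ^ 2) ≤ potential s (nestedStep s z v) := by
  obtain ⟨i, c, x⟩ := z
  simp only at hz
  have h1 := norm_add_sq_eq (x - c) v
  have e : x - c + v = x + v - c := by abel
  rw [e] at h1
  by_cases hj : radius s i ≤ ‖x + v - c‖
  · have h2 : radius s i ^ 2 ≤ ‖x + v - c‖ ^ 2 := by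
      have := radius_nonneg hs i
      gcongr
    simp only [nestedStep, hz, hj, and_self, if_true, potential, sub_nestedStep_center, norm_smul,
      mul_pow, Real.norm_eq_abs, sq_abs]
    unfold radius at h2
    interval_cases i <;> norm_num at h2 ⊢ <;> nlinarith
  · simp only [nestedStep, hz, hj, and_false, if_false, potential, if_true]
    linarith

lemma nestedChain_fst_mono (s : ℝ) (v : ℕ → EuclideanSpace ℝ (Fin n)) :
    Monotone fun k => (nestedChain s v k).1 := by
  refine monotone_nat_of_le_succ fun k => ?_
  simp only [nestedChain, nestedStep]
  split_ifs <;> simp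

lemma nestedChain_snd_snd (s : ℝ) (v : ℕ → EuclideanSpace ℝ (Fin n)) (k : ℕ) :
    (nestedChain s v k).2.2 = ∑ i ∈ Finset.range k, v i := by
  induction k with
  | zero => simp [nestedChain]
  | succ k ih =>
    rw [Finset.sum_range_succ, ← ih]
    simp only [nestedChain, nestedStep]
    split_ifs <;> simp

/-- A crude bound, needed only for integrability. -/
lemma norm_nestedChain_sub_le (s : ℝ) (v : ℕ → EuclideanSpace ℝ (Fin n)) (k : ℕ) :
    ‖(nestedChain s v k).2.2 - (nestedChain s v k).2.1‖ ≤ ∑ i ∈ Finset.range k, ‖v i‖ := by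
  induction k with
  | zero => simp [nestedChain]
  | succ k ih =>
    rw [Finset.sum_range_succ]
    set z := nestedChain s v k with hz
    have h1 : ‖z.2.2 + v k - z.2.1‖ ≤ ∑ i ∈ Finset.range k, ‖v i‖ + ‖v k‖ := by
      rw [show z.2.2 + v k - z.2.1 = (z.2.2 - z.2.1) + v k by abel]
      exact (norm_add_le _ _).trans (by gcongr)
    simp only [nestedChain, nestedStep, ← hz]
    split_ifs
    · simp only [sub_nestedStep_center]
      refine (norm_smul_le _ _).trans (le_trans ?_ h1)
      refine mul_le_of_le_one_left (norm_nonneg _) ?_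
      have h2 : (2 + (z.1 : ℝ))⁻¹ ≤ 1 := inv_le_one_of_one_le₀ (by
        have : (0 : ℝ) ≤ z.1 := by positivity
        linarith)
      have h3 : 0 ≤ (2 + (z.1 : ℝ))⁻¹ := by positivity
      rw [Real.norm_eq_abs, abs_le]
      constructor <;> linarith
    · exact h1

/-- If the steps are small and the last ball has not been left, then all the points visited so far
are close to the current ball. -/
lemma norm_walk_sub_nestedChain_le {s ε : ℝ} (hε : 0 ≤ ε) (hsε : 4 * ε ≤ s)
    (v : ℕ → EuclideanSpace ℝ (Fin n)) (k : ℕ) (hv : ∀ i < k, ‖v i‖ ≤ ε)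
    (hk : (nestedChain s v k).1 < 3) :
    ‖(nestedChain s v k).2.2 - (nestedChain s v k).2.1‖ ≤ radius s (nestedChain s v k).1 ∧
    ∀ l ≤ k, ‖∑ i ∈ Finset.range l, v i - (nestedChain s v k).2.1‖ ≤
      radius s (nestedChain s v k).1 + (nestedChain s v k).1 * ε := by
  have hs : 0 ≤ s := by linarith
  induction k with
  | zero =>
    have := radius_nonneg hs 0
    simpa [nestedChain] using this
  | succ k ih =>
    have hk' : (nestedChain s v k).1 < 3 := (nestedChain_fst_mono s v (Nat.le_succ k)).trans_lt hk
    obtain ⟨h1, h2⟩ := ih (fun i hi => hv i (by omega)) hk'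
    have hx := nestedChain_snd_snd s v k
    have hvk := hv k (Nat.lt_succ_self k)
    have hstep : nestedChain s v (k + 1) = nestedStep s (nestedChain s v k) (v k) := rfl
    have hx' : ∑ i ∈ Finset.range (k + 1), v i = (nestedChain s v k).2.2 + v k := by
      rw [Finset.sum_range_succ, hx]
    rw [hstep] at hk ⊢
    generalize nestedChain s v k = z at *
    obtain ⟨i, c, x⟩ := z
    simp only at *
    by_cases hj : radius s i ≤ ‖x + v k - c‖
    · have hy : ‖x + v k - c‖ ≤ radius s i + ε := by
        rw [show x + v k - c = (x - c) + v k by abel]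
        exact (norm_add_le _ _).trans (by gcongr)
      simp only [nestedStep, hk', hj, and_self, if_true] at hk ⊢
      have hi0 : (0 : ℝ) ≤ i := by positivity
      have hl : (0 : ℝ) ≤ (2 + (i : ℝ))⁻¹ := by positivity
      have hl1 : (2 + (i : ℝ))⁻¹ ≤ 1 := inv_le_one_of_one_le₀ (by linarith)
      have hr : (2 + (i : ℝ))⁻¹ * radius s i = s / 4 := by unfold radius; field_simp
      have hr' : radius s (i + 1) = radius s i + s / 4 := by unfold radius; push_cast; ring
      have hlast : ‖x + v k - (c + (2 + (i : ℝ))⁻¹ • (x + v k - c))‖ ≤ radius s (i + 1) := by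
        rw [sub_nestedStep_center, norm_smul, Real.norm_of_nonneg (by linarith), hr']
        have := mul_le_mul_of_nonneg_left hy (sub_nonneg.2 hl1)
        nlinarith
      refine ⟨hlast, fun l hl' => ?_⟩
      rcases Nat.lt_or_ge k l with hlt | hle
      · have : l = k + 1 := by omega
        rw [this, hx']
        refine hlast.trans ?_
        have : (0 : ℝ) ≤ ((i + 1 : ℕ) : ℝ) * ε := by positivity
        linarith
      · have h3 := h2 l hle
        rw [← sub_sub]
        refine (norm_sub_le _ _).trans ?_
        -- The centre moves by at most s/4 + ε: the s/4 is absorbed by the larger radius, the ε by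
        -- the increased index.
        rw [norm_smul, Real.norm_of_nonneg hl, hr']
        have := mul_le_mul_of_nonneg_left hy hl
        push_cast
        nlinarith
    · simp only [nestedStep, hk', hj, and_false, if_false] at hk ⊢
      have hlast := (not_le.1 hj).le
      refine ⟨hlast, fun l hl' => ?_⟩
      rcases Nat.lt_or_ge k l with hlt | hle
      · have : l = k + 1 := by omega
        rw [this, hx']
        refine hlast.trans ?_
        have : (0 : ℝ) ≤ (i : ℝ) * ε := by positivity
        linarith
      · exact h2 l hle

variable {Ω : Type*} [mΩ : MeasurableSpace Ω] {ξ : ℕ → Ω → EuclideanSpace ℝ (Fin n)}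
  {h : ℝ≥0} {P : Measure Ω}

/-- The event that the last of the nested balls has not been left after `k` steps. -/
def inside {Ω : Type*} (s : ℝ) (ξ : ℕ → Ω → EuclideanSpace ℝ (Fin n)) (k : ℕ) : Set Ω :=
  {ω | (nestedChain s (fun i => ξ i ω) k).1 < 3}

lemma measurable_nestedStep (s : ℝ) :
    Measurable fun p : (ℕ × EuclideanSpace ℝ (Fin n) × EuclideanSpace ℝ (Fin n)) ×
      EuclideanSpace ℝ (Fin n) => nestedStep s p.1 p.2 := by
  have hi : Measurable fun p : (ℕ × EuclideanSpace ℝ (Fin n) × EuclideanSpace ℝ (Fin n)) ×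
      EuclideanSpace ℝ (Fin n) => p.1.1 := by fun_prop
  have h1 : Measurable fun p : (ℕ × EuclideanSpace ℝ (Fin n) × EuclideanSpace ℝ (Fin n)) ×
      EuclideanSpace ℝ (Fin n) => radius s p.1.1 := (measurable_of_countable (radius s)).comp hi
  have h2 : Measurable fun p : (ℕ × EuclideanSpace ℝ (Fin n) × EuclideanSpace ℝ (Fin n)) ×
      EuclideanSpace ℝ (Fin n) => (2 + (p.1.1 : ℝ))⁻¹ :=
    (measurable_of_countable fun i : ℕ => (2 + (i : ℝ))⁻¹).comp hi
  have h3 : Measurable fun p : (ℕ × EuclideanSpace ℝ (Fin n) × EuclideanSpace ℝ (Fin n)) ×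
      EuclideanSpace ℝ (Fin n) => p.1.1 + 1 := (measurable_of_countable fun i : ℕ => i + 1).comp hi
  refine Measurable.ite ?_ ?_ ?_
  · exact (measurableSet_lt hi measurable_const).inter (measurableSet_le h1 (by fun_prop))
  · exact h3.prodMk (by fun_prop)
  · fun_prop

lemma measurable_past_nestedChain {Ω : Type*} (s : ℝ) (ξ : ℕ → Ω → EuclideanSpace ℝ (Fin n))
    (k : ℕ) : Measurable[past ξ k] fun ω => nestedChain s (fun i => ξ i ω) k := by
  induction k with
  | zero => exact measurable_const
  | succ k ih =>
    have h1 := ih.mono (past_mono ξ (Nat.le_succ k)) le_rfl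
    exact (measurable_nestedStep s).comp (h1.prodMk (measurable_past_succ ξ k))

lemma measurableSet_inside {Ω : Type*} (s : ℝ) (ξ : ℕ → Ω → EuclideanSpace ℝ (Fin n))
    (k : ℕ) : MeasurableSet[past ξ k] (inside s ξ k) :=
  (measurable_fst.comp (measurable_past_nestedChain s ξ k)) (measurableSet_Iio (a := 3))

/-- Telescopes `potential_sub_le` from the initial value (3/2) s²; at index K the potential is at
most that value if still inside and 0 otherwise. -/
lemma le_sum_inside {Ω : Type*} {s : ℝ} (hs : 0 ≤ s) (ξ : ℕ → Ω → EuclideanSpace ℝ (Fin n)) (K : ℕ) (ω : Ω) :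
    s ^ 2 * (3 / 2) - (inside s ξ K).indicator (fun _ => s ^ 2 * (3 / 2)) ω ≤
    ∑ k ∈ Finset.range K, (2 * inner ℝ ((inside s ξ k).indicator (fun ω =>
      (nestedChain s (fun i => ξ i ω) k).2.2 - (nestedChain s (fun i => ξ i ω) k).2.1) ω) (ξ k ω) +
      (inside s ξ k).indicator 1 ω * ‖ξ k ω‖ ^ 2) := by
  have h1 : potential s (nestedChain s (fun i => ξ i ω) K) ≤
      (inside s ξ K).indicator (fun _ => s ^ 2 * (3 / 2)) ω := by
    by_cases hK : ω ∈ inside s ξ K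
    · rw [Set.indicator_of_mem hK, potential_of_lt s hK]
      have : (0 : ℝ) ≤ (nestedChain s (fun i => ξ i ω) K).1 := by positivity
      have := mul_nonneg (sq_nonneg s)
        (by positivity : (0 : ℝ) ≤ (nestedChain s (fun i => ξ i ω) K).1 ^ 2 +
          2 * (nestedChain s (fun i => ξ i ω) K).1)
      nlinarith [sq_nonneg ‖(nestedChain s (fun i => ξ i ω) K).2.2 -
        (nestedChain s (fun i => ξ i ω) K).2.1‖]
    · rw [Set.indicator_of_notMem hK, potential_of_not_lt s hK]
  refine (sub_le_sub_left h1 _).trans ?_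
  clear h1
  induction K with
  | zero =>
    simp [nestedChain, potential]
    ring_nf
    rfl
  | succ K ih =>
    rw [Finset.sum_range_succ]
    by_cases hK : ω ∈ inside s ξ K
    · have h2 := potential_sub_le hs (nestedChain s (fun i => ξ i ω) K) (ξ K ω) hK
      rw [Set.indicator_of_mem hK, Set.indicator_of_mem hK, Pi.one_apply, one_mul]
      have h3 : nestedChain s (fun i => ξ i ω) (K + 1) =
        nestedStep s (nestedChain s (fun i => ξ i ω) K) (ξ K ω) := rfl
      rw [h3]
      linarith
    · have hK' : ω ∉ inside s ξ (K + 1) := fun hc =>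
        hK (lt_of_le_of_lt (nestedChain_fst_mono s _ (Nat.le_succ K)) hc)
      rw [Set.indicator_of_notMem hK, Set.indicator_of_notMem hK, inner_zero_left]
      rw [potential_of_not_lt s hK] at ih
      rw [potential_of_not_lt s hK']
      linarith

namespace IsGaussianStep

lemma le_sum_measureReal_inside (hξ : IsGaussianStep ξ h P) {s : ℝ} (hs : 0 ≤ s) (K : ℕ) :
    s ^ 2 * (3 / 2) ≤ n * h * ∑ k ∈ Finset.range K, P.real (inside s ξ k) +
      s ^ 2 * (3 / 2) * P.real (inside s ξ K) := by
  have := hξ.isProbabilityMeasure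
  have hAm : ∀ k, MeasurableSet (inside s ξ k) := fun k =>
    hξ.past_le k _ (measurableSet_inside s ξ k)
  have hy : ∀ k, Measurable[past ξ k] fun ω =>
      (nestedChain s (fun i => ξ i ω) k).2.2 - (nestedChain s (fun i => ξ i ω) k).2.1 := fun k =>
    (by fun_prop : Measurable fun z : ℕ × EuclideanSpace ℝ (Fin n) × EuclideanSpace ℝ (Fin n) =>
      z.2.2 - z.2.1).comp (measurable_past_nestedChain s ξ k)
  have hyi : ∀ k, Integrable (fun ω =>
      (nestedChain s (fun i => ξ i ω) k).2.2 - (nestedChain s (fun i => ξ i ω) k).2.1) P := by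
    intro k
    refine (integrable_finsetSum (Finset.range k) fun i _ => (hξ.integrable i).norm).mono'
      ((hy k).mono (hξ.past_le k) le_rfl).aestronglyMeasurable ?_
    filter_upwards with ω
    exact norm_nestedChain_sub_le s _ k
  obtain ⟨h1, h2⟩ := hξ.integral_sum_indicator_step K (A := inside s ξ)
    (u := fun k => (inside s ξ k).indicator fun ω =>
      (nestedChain s (fun i => ξ i ω) k).2.2 - (nestedChain s (fun i => ξ i ω) k).2.1)
    (measurableSet_inside s ξ) (fun k => (hy k).indicator (measurableSet_inside s ξ k))
    (fun k => (hyi k).indicator (hAm k))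
  have h3 : Integrable ((inside s ξ K).indicator (fun _ => s ^ 2 * (3 / 2))) P :=
    (integrable_const _).indicator (hAm K)
  have h4 := integral_mono ((integrable_const _).sub h3) h1 (le_sum_inside hs ξ K)
  simp only [Pi.sub_apply] at h4
  rw [h2, integral_sub (integrable_const _) h3, integral_indicator_const _ (hAm K)] at h4
  simp only [integral_const, probReal_univ, smul_eq_mul] at h4
  linarith

/-- The events decrease, so the terminal probability is at most their average. This absorbs the
terminal term without showing that the balls are eventually left. -/
lemma le_sum_measureReal_inside' (hξ : IsGaussianStep ξ h P) {s : ℝ} (hs : 0 ≤ s) (K : ℕ) :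
    K * (s ^ 2 * (3 / 2)) ≤
      (n * (K * h) + s ^ 2 * (3 / 2)) * ∑ k ∈ Finset.range K, P.real (inside s ξ k) := by
  have := hξ.isProbabilityMeasure
  have h1 := hξ.le_sum_measureReal_inside hs K
  have h2 : K * P.real (inside s ξ K) ≤ ∑ k ∈ Finset.range K, P.real (inside s ξ k) := by
    have : ∀ k ∈ Finset.range K, P.real (inside s ξ K) ≤ P.real (inside s ξ k) := fun k hk => by
      refine measureReal_mono fun ω hω => ?_
      exact lt_of_le_of_lt (nestedChain_fst_mono s _ (Finset.mem_range.1 hk).le) hω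
    simpa using Finset.card_nsmul_le_sum _ _ _ this
  have h3 := mul_le_mul_of_nonneg_left h1 (Nat.cast_nonneg (α := ℝ) K)
  have h4 := mul_le_mul_of_nonneg_left h2 (by positivity : 0 ≤ s ^ 2 * (3 / 2))
  nlinarith

end IsGaussianStep

end NestedBalls

open Filter Topology

/-! ### Deterministic geometry of hulls and circumradii. -/

section Geometry

variable {Ω : Type*} {n : ℕ} {W : ℝ≥0 → Ω → EuclideanSpace ℝ (Fin n)} {ω : Ω}

lemma circumradius_le {K : Set (EuclideanSpace ℝ (Fin n))} {p : EuclideanSpace ℝ (Fin n)} {r : ℝ≥0}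
    (hK : K ⊆ Metric.closedBall p r) : circumradius K ≤ r :=
  iInf_le_of_le p (iInf₂_le r hK)

lemma circumradius_mono {K L : Set (EuclideanSpace ℝ (Fin n))} (hKL : K ⊆ L) :
    circumradius K ≤ circumradius L :=
  le_iInf fun _ => le_iInf₂ fun _ hr => circumradius_le (hKL.trans hr)

lemma edist_le_two_mul_circumradius {K : Set (EuclideanSpace ℝ (Fin n))}
    {x y : EuclideanSpace ℝ (Fin n)} (hx : x ∈ K) (hy : y ∈ K) :
    edist x y ≤ 2 * circumradius K := by
  simp only [circumradius, ENNReal.mul_iInf_of_ne two_ne_zero ENNReal.ofNat_ne_top]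
  refine le_iInf fun p => le_iInf₂ fun r hr => ?_
  have h1 : edist x p ≤ r := by
    rw [edist_nndist]
    exact_mod_cast Metric.mem_closedBall.1 (hr hx)
  have h2 : edist y p ≤ r := by
    rw [edist_nndist]
    exact_mod_cast Metric.mem_closedBall.1 (hr hy)
  rw [two_mul]
  exact (edist_triangle_right x y p).trans (add_le_add h1 h2)

lemma mem_hull {s t : ℝ≥0} (hst : s ≤ t) : W s ω ∈ hull W t ω :=
  subset_convexHull ℝ _ ⟨s, hst, rfl⟩

lemma hull_mono {s t : ℝ≥0} (hst : s ≤ t) : hull W s ω ⊆ hull W t ω :=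
  convexHull_mono fun _ ⟨r, hr, hx⟩ => ⟨r, hr.trans hst, hx⟩

lemma hull_subset_closedBall {t : ℝ≥0} {p : EuclideanSpace ℝ (Fin n)} {r : ℝ}
    (h : ∀ s ≤ t, dist (W s ω) p ≤ r) : hull W t ω ⊆ Metric.closedBall p r :=
  convexHull_min (fun _ ⟨s, hs, hx⟩ => hx ▸ h s hs) (convex_closedBall p r)

lemma le_inverseCircumradius {t y : ℝ≥0} (h : circumradius (hull W t ω) ≤ y) :
    (t : ℝ≥0∞) ≤ inverseCircumradius W y ω := by
  refine le_iInf₂ fun s hs => ?_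
  by_contra hc
  have hst : s ≤ t := by exact_mod_cast (not_le.1 hc).le
  exact absurd (hs.trans_le ((circumradius_mono (hull_mono hst)).trans h)) (lt_irrefl _)

lemma inverseCircumradius_le {t y : ℝ≥0} (h : y < circumradius (hull W t ω)) :
    inverseCircumradius W y ω ≤ t :=
  iInf₂_le t h

/-- For a continuous path, the circumradius of the hull is determined by countably many centres
and countably many times. -/
lemma circumradius_hull_eq (hc : Continuous fun t => W t ω) (t : ℝ≥0) :
    circumradius (hull W t ω) = ⨅ i, ⨆ j, edist (W (min (TopologicalSpace.denseSeq ℝ≥0 j) t) ω)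
      (TopologicalSpace.denseSeq (EuclideanSpace ℝ (Fin n)) i) := by
  refine le_antisymm (le_iInf fun i => ?_) (le_iInf fun p => le_iInf₂ fun r hr => ?_)
  · set p := TopologicalSpace.denseSeq (EuclideanSpace ℝ (Fin n)) i
    set a := ⨆ j, edist (W (min (TopologicalSpace.denseSeq ℝ≥0 j) t) ω) p with ha
    -- Continuity extends the bound from the dense times to all times; `min s t` keeps them in [0,
    -- t].
    have hclosed : IsClosed {s | edist (W (min s t) ω) p ≤ a} :=
      isClosed_le ((hc.comp (continuous_id.min continuous_const)).edist continuous_const)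
        continuous_const
    have huniv : ∀ s, edist (W (min s t) ω) p ≤ a := fun s =>
      hclosed.closure_subset_iff.2 (Set.range_subset_iff.2 fun j =>
        le_iSup (fun j => edist (W (min (TopologicalSpace.denseSeq ℝ≥0 j) t) ω) p) j)
        (TopologicalSpace.denseRange_denseSeq ℝ≥0 s)
    rcases eq_or_ne a ⊤ with htop | htop
    · rw [htop]; exact le_top
    · rw [← ENNReal.coe_toNNReal htop] at huniv ⊢
      refine circumradius_le (p := p) (hull_subset_closedBall fun s hs => ?_)
      have h1 := huniv s
      rw [min_eq_left hs, edist_nndist] at h1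
      exact_mod_cast h1
  · refine ENNReal.le_of_forall_pos_le_add fun ε hε _ => ?_
    obtain ⟨i, hi⟩ := (TopologicalSpace.denseRange_denseSeq
      (EuclideanSpace ℝ (Fin n))).exists_dist_lt p (NNReal.coe_pos.2 hε)
    refine iInf_le_of_le i (iSup_le fun j => (edist_triangle _ p _).trans (add_le_add ?_ ?_))
    · have h1 := hr (mem_hull (W := W) (ω := ω)
        (min_le_right (TopologicalSpace.denseSeq ℝ≥0 j) t))
      rw [edist_nndist]
      exact_mod_cast h1
    · rw [edist_nndist]
      exact_mod_cast hi.le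

/-- Hulls grow with time, so a dense set of times suffices, with no continuity of the path. -/
lemma inverseCircumradius_eq (W : ℝ≥0 → Ω → EuclideanSpace ℝ (Fin n)) (y : ℝ≥0) (ω : Ω) :
    inverseCircumradius W y ω =
      ⨅ q, if (y : ℝ≥0∞) < circumradius (hull W (TopologicalSpace.denseSeq ℝ≥0 q) ω) then
        (TopologicalSpace.denseSeq ℝ≥0 q : ℝ≥0∞) else ⊤ := by
  refine le_antisymm (le_iInf fun q => ?_) (le_iInf₂ fun t ht => ?_)
  · split_ifs with h
    · exact inverseCircumradius_le h
    · exact le_top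
  · refine ENNReal.le_of_forall_pos_le_add fun ε hε _ => ?_
    obtain ⟨_, ⟨q, rfl⟩, h1, h2⟩ := (TopologicalSpace.denseRange_denseSeq ℝ≥0).exists_between
      (lt_add_of_pos_right t hε)
    refine iInf_le_of_le q ?_
    rw [if_pos (ht.trans_le (circumradius_mono (hull_mono h1.le)))]
    exact_mod_cast h2.le

/-- If the path oscillates little on the mesh `h` and the chain of nested balls is still inside
after `k` steps, then the hull is contained in a ball of radius `1`. -/
lemma circumradius_hull_le_one_of_mem_inside {ξ : ℕ → Ω → EuclideanSpace ℝ (Fin n)} {h T : ℝ≥0}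
    (hh : 0 < h) (hmod : ∀ a ≤ T, ∀ b ≤ T, dist a b ≤ h → dist (W a ω) (W b ω) ≤ 1 / 300)
    (hwalk : ∀ k : ℕ, walk ξ k ω = W (k * h) ω) {k : ℕ} (hk : k * h ≤ T)
    (hin : ω ∈ inside (99 / 100) ξ k) : circumradius (hull W (k * h) ω) ≤ 1 := by
  have hle : ∀ j ≤ k, j * h ≤ T := fun j hj => le_trans (by gcongr) hk
  have hv : ∀ i < k, ‖ξ i ω‖ ≤ 1 / 300 := by
    intro i hi
    have e : ξ i ω = walk ξ (i + 1) ω - walk ξ i ω := by simp [walk, Finset.sum_range_succ]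
    rw [e, hwalk, hwalk, ← dist_eq_norm]
    refine hmod _ (hle (i + 1) hi) _ (hle i hi.le) ?_
    rw [NNReal.dist_eq]
    push_cast
    rw [show ((i : ℝ) + 1) * h - i * h = h by ring, abs_of_nonneg h.coe_nonneg]
  obtain ⟨-, h2⟩ := norm_walk_sub_nestedChain_le (s := 99 / 100) (ε := 1 / 300) (by norm_num)
    (by norm_num) (fun i => ξ i ω) k hv hin
  have hin' : (nestedChain (99 / 100) (fun i => ξ i ω) k).1 < 3 := hin
  generalize nestedChain (99 / 100) (fun i => ξ i ω) k = z at h2 hin'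
  -- The margin 1 - 99/100 = 3/300 is used up exactly: two changes of ball cost 1/300 each, and the
  -- oscillation between grid times takes the third.
  have hz : radius (99 / 100) z.1 + z.1 * (1 / 300) ≤ 1 - 1 / 300 := by
    have h3 : (z.1 : ℝ) ≤ 2 := by exact_mod_cast Nat.le_of_lt_succ hin'
    unfold radius
    linarith
  refine circumradius_le (p := z.2.1) (hull_subset_closedBall fun t ht => ?_)
  have hl := Nat.floor_le (zero_le (a := t / h))
  have hl' := Nat.lt_floor_add_one (t / h)
  rw [le_div_iff₀ hh] at hl
  rw [div_lt_iff₀ hh] at hl'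
  have hlk : ⌊t / h⌋₊ ≤ k := by
    have h5 : ((⌊t / h⌋₊ : ℝ≥0)) ≤ k := le_of_mul_le_mul_right (hl.trans ht) hh
    exact_mod_cast h5
  have h6 := h2 _ hlk
  have h7 : ∑ i ∈ Finset.range ⌊t / h⌋₊, ξ i ω = W (⌊t / h⌋₊ * h) ω := hwalk _
  rw [h7, ← dist_eq_norm] at h6
  have h8 : dist (W t ω) (W (⌊t / h⌋₊ * h) ω) ≤ 1 / 300 := by
    refine hmod _ (ht.trans hk) _ (hle _ hlk) ?_
    rw [← NNReal.coe_le_coe] at hl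
    rw [← NNReal.coe_lt_coe] at hl'
    rw [NNReal.dist_eq, abs_le]
    push_cast at hl hl' ⊢
    constructor <;> nlinarith [h.coe_nonneg]
  have := dist_triangle (W t ω) (W (⌊t / h⌋₊ * h) ω) z.2.1
  simp only [NNReal.coe_one]
  linarith

/-! ### Time spent in events along the grid. -/

/-- The time spent in the events `A k`, `k < K`, when each index stands for a duration `h`. -/
noncomputable def occupation (A : ℕ → Set Ω) (h : ℝ≥0) (K : ℕ) (ω : Ω) : ℝ≥0∞ :=
  h * ∑ k ∈ Finset.range K, (A k).indicator 1 ω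

lemma occupation_succ (A : ℕ → Set Ω) (h : ℝ≥0) (K : ℕ) (ω : Ω) :
    occupation A h (K + 1) ω = occupation A h K ω + h * (A K).indicator 1 ω := by
  simp [occupation, Finset.sum_range_succ, mul_add]

lemma occupation_le_mul (A : ℕ → Set Ω) (h : ℝ≥0) (K : ℕ) (ω : Ω) :
    occupation A h K ω ≤ K * h := by
  rw [occupation, mul_comm]
  gcongr
  refine (Finset.sum_le_card_nsmul _ _ 1 fun k _ => ?_).trans (by simp)
  exact Set.indicator_le_self' (by simp) ω

/-- If k is the last index below K with ω in `A k`, the occupation time is at most (k + 1) h; hence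
the extra h. -/
lemma occupation_le_add {A : ℕ → Set Ω} {h : ℝ≥0} {K : ℕ} {x : ℝ≥0∞}
    (hA : ∀ k < K, ω ∈ A k → k * h ≤ x) : occupation A h K ω ≤ x + h := by
  induction K with
  | zero => simp [occupation]
  | succ K ih =>
    by_cases hK : ω ∈ A K
    · refine (occupation_le_mul A h (K + 1) ω).trans ?_
      push_cast
      rw [add_mul, one_mul]
      gcongr
      exact hA K (Nat.lt_succ_self K) hK
    · rw [occupation_succ, Set.indicator_of_notMem hK, mul_zero, add_zero]
      exact ih fun k hk => hA k (by omega)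

lemma min_le_occupation {A : ℕ → Set Ω} {h : ℝ≥0} {x : ℝ≥0∞} (K : ℕ)
    (hA : ∀ k, ω ∉ A k → x ≤ k * h) : min x (K * h) ≤ occupation A h K ω := by
  induction K with
  | zero => simp
  | succ K ih =>
    rw [occupation_succ]
    by_cases hK : ω ∈ A K
    · rw [Set.indicator_of_mem hK, Pi.one_apply, mul_one]
      refine le_trans ?_ (add_le_add_left ih _)
      rw [← min_add_add_right]
      push_cast
      rw [add_mul, one_mul]
      exact min_le_min_right _ le_self_add
    · rw [Set.indicator_of_notMem hK, mul_zero, add_zero]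
      exact (min_le_left _ _).trans ((le_min le_rfl (hA K hK)).trans ih)

lemma inverseCircumradius_le_of_notMem_stays {ξ : ℕ → Ω → EuclideanSpace ℝ (Fin n)} {h : ℝ≥0}
    (hwalk : ∀ k : ℕ, walk ξ k ω = W (k * h) ω) {k : ℕ} (hk : ω ∉ stays ξ 2 k) :
    inverseCircumradius W 1 ω ≤ k * h := by
  simp only [stays, Set.mem_ofPred_eq, not_forall, not_le] at hk
  obtain ⟨j, hj, hlt⟩ := hk
  have h1 := edist_le_two_mul_circumradius (mem_hull (W := W) (ω := ω)
    (show j * h ≤ k * h by gcongr)) (mem_hull (W := W) (ω := ω) (zero_le (a := k * h)))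
  have h0 : W 0 ω = 0 := by simpa [walk] using (hwalk 0).symm
  rw [← hwalk j, h0, edist_zero_right] at h1
  have h2 : 2 < ‖walk ξ j ω‖ₑ := by
    rw [← ofReal_norm]
    exact (ENNReal.lt_ofReal_iff_toReal_lt (by simp)).2 (by simpa using hlt)
  have h3 : ((1 : ℝ≥0) : ℝ≥0∞) < circumradius (hull W (k * h) ω) := by
    by_contra hc
    refine absurd (h2.trans_le h1) (not_lt.2 ?_)
    calc 2 * circumradius (hull W (k * h) ω) ≤ 2 * ((1 : ℝ≥0) : ℝ≥0∞) := by
          gcongr; exact not_lt.1 hc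
      _ = 2 := by simp
  simpa using inverseCircumradius_le h3

end Geometry

/-! ### From Brownian motion to the grid walk. -/

section Brownian

variable {Ω : Type*} [mΩ : MeasurableSpace Ω] {n : ℕ} {W : ℝ≥0 → Ω → EuclideanSpace ℝ (Fin n)}
  {P : Measure Ω}

lemma lintegral_occupation [IsProbabilityMeasure P] {A : ℕ → Set Ω} (hA : ∀ k, MeasurableSet (A k))
    (h : ℝ≥0) (K : ℕ) : Measurable (occupation A h K) ∧
      ∫⁻ ω, occupation A h K ω ∂P =
        ENNReal.ofReal (h * ∑ k ∈ Finset.range K, P.real (A k)) := by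
  have hm : ∀ k, Measurable ((A k).indicator (1 : Ω → ℝ≥0∞)) := fun k =>
    measurable_one.indicator (hA k)
  have hs : Measurable fun ω => ∑ k ∈ Finset.range K, (A k).indicator (1 : Ω → ℝ≥0∞) ω :=
    Finset.measurable_fun_sum _ fun k _ => hm k
  refine ⟨hs.const_mul _, ?_⟩
  unfold occupation
  rw [lintegral_const_mul _ hs, lintegral_finsetSum _ fun k _ => hm k,
    ENNReal.ofReal_mul h.coe_nonneg, ENNReal.ofReal_sum_of_nonneg fun k _ => measureReal_nonneg]
  simp [lintegral_indicator_one (hA _)]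

namespace IsBrownianMotion

lemma aemeasurable (hW : IsBrownianMotion W P) (t : ℝ≥0) : AEMeasurable (W t) P :=
  (MeasurableEquiv.toLp 2 (Fin n → ℝ)).measurable.comp_aemeasurable
    (aemeasurable_pi_lambda (fun ω j => W t ω j) fun j => (hW.coord j).aemeasurable t)

lemma ae_continuous (hW : IsBrownianMotion W P) : ∀ᵐ ω ∂P, Continuous fun t => W t ω := by
  filter_upwards [ae_all_iff.2 fun j => (hW.coord j).cont] with ω hω
  exact (PiLp.continuous_toLp 2 _).comp (continuous_pi hω)

lemma ae_zero (hW : IsBrownianMotion W P) : ∀ᵐ ω ∂P, W 0 ω = 0 := by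
  filter_upwards [ae_all_iff.2 fun j => (hW.coord j).eval_zero_ae_eq_zero] with ω hω
  ext j
  exact hω j

/-- Along a grid of mesh `h`, Brownian motion is almost surely a random walk with Gaussian steps. -/
lemma exists_isGaussianStep (hW : IsBrownianMotion W P) (h : ℝ≥0) :
    ∃ ξ : ℕ → Ω → EuclideanSpace ℝ (Fin n), IsGaussianStep ξ h P ∧
      ∀ᵐ ω ∂P, ∀ k : ℕ, walk ξ k ω = W (k * h) ω := by
  -- The increments are only a.e. measurable. Measurable versions make `past` a sub-σ-algebra, at
  -- the price of an almost sure identity with W.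
  have hmeas : ∀ k : ℕ, AEMeasurable (fun ω => W ((k + 1 : ℕ) * h) ω - W (k * h) ω) P := fun k =>
    (hW.aemeasurable _).sub (hW.aemeasurable _)
  have hae : ∀ k, (hmeas k).mk =ᵐ[P] fun ω => W ((k + 1 : ℕ) * h) ω - W (k * h) ω := fun k =>
    (hmeas k).ae_eq_mk.symm
  have hcoord : ∀ (j : Fin n) (k : ℕ), (fun ω => (hmeas k).mk _ ω j) =ᵐ[P]
      fun ω => W ((k + 1 : ℕ) * h) ω j - W (k * h) ω j := fun j k => by
    filter_upwards [hae k] with ω hω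
    rw [hω]; rfl
  refine ⟨fun k => (hmeas k).mk, ⟨fun k => (hmeas k).measurable_mk, ?_, fun k j => ?_⟩, ?_⟩
  · refine iIndepFun_uncurry' (X := fun (j : Fin n) (k : ℕ) ω => (hmeas k).mk _ ω j)
      (fun j k => ?_) ?_ fun j => ?_
    · have := (hmeas k).measurable_mk
      fun_prop
    · have h1 := hW.indep.comp
        (fun _ (w : ℝ≥0 → ℝ) (k : ℕ) => w ((k + 1 : ℕ) * h) - w (k * h)) (by fun_prop)
      refine h1.congr fun j => ?_
      filter_upwards [ae_all_iff.2 (hcoord j)] with ω hω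
      ext k
      exact (hω k).symm
    · have hmono : Monotone fun k : ℕ => (k : ℝ≥0) * h := fun a b hab => by
        dsimp only; gcongr
      exact ((hW.coord j).hasIndepIncrements.nat hmono).congr fun k => (hcoord j k).symm
  · have h1 := (hW.coord j).hasLaw_sub ((k + 1 : ℕ) * h) (k * h)
    have e : nndist ((k + 1 : ℕ) * h : ℝ≥0).1 (k * h : ℝ≥0).1 = h := by
      ext
      rw [coe_nndist, Real.dist_eq]
      simp only [NNReal.val_eq_coe]
      push_cast
      rw [show ((k : ℝ) + 1) * h - k * h = h by ring, abs_of_nonneg h.coe_nonneg]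
    rw [e] at h1
    exact h1.congr (hcoord j k)
  · filter_upwards [ae_all_iff.2 hae, hW.ae_zero] with ω hω h0 k
    unfold walk
    simp_rw [hω]
    rw [Finset.sum_range_sub (fun k : ℕ => W (k * h) ω)]
    simp [h0]

/-! ### Measurability, and the two bounds in the limit of fine grids. -/

lemma aemeasurable_circumradius (hW : IsBrownianMotion W P) (t : ℝ≥0) :
    AEMeasurable (fun ω => circumradius (hull W t ω)) P := by
  have h1 : AEMeasurable (fun ω => ⨅ i, ⨆ j,
      edist (W (min (TopologicalSpace.denseSeq ℝ≥0 j) t) ω)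
      (TopologicalSpace.denseSeq (EuclideanSpace ℝ (Fin n)) i)) P :=
    AEMeasurable.iInf fun i => AEMeasurable.iSup fun j =>
      (hW.aemeasurable _).edist aemeasurable_const
  refine h1.congr ?_
  filter_upwards [hW.ae_continuous] with ω hω
  exact (circumradius_hull_eq hω t).symm

lemma aemeasurable_inverseCircumradius (hW : IsBrownianMotion W P) (y : ℝ≥0) :
    AEMeasurable (inverseCircumradius W y) P := by
  -- Each term of the infimum becomes a fixed Borel function of a circumradius.
  have e : inverseCircumradius W y = fun ω => ⨅ q,
      {x : ℝ≥0∞ | (y : ℝ≥0∞) < x}.indicator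
        (fun _ => (TopologicalSpace.denseSeq ℝ≥0 q : ℝ≥0∞))
        (circumradius (hull W (TopologicalSpace.denseSeq ℝ≥0 q) ω)) +
      {x : ℝ≥0∞ | x ≤ y}.indicator (fun _ => ⊤)
        (circumradius (hull W (TopologicalSpace.denseSeq ℝ≥0 q) ω)) := by
    ext ω
    rw [inverseCircumradius_eq]
    congr 1
    ext q
    by_cases hq : (y : ℝ≥0∞) < circumradius (hull W (TopologicalSpace.denseSeq ℝ≥0 q) ω)
    · simp [hq]
    · simp [hq, not_lt.1 hq]
  rw [e]
  refine AEMeasurable.iInf fun q => AEMeasurable.add ?_ ?_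
  · exact (measurable_const.indicator measurableSet_Ioi).comp_aemeasurable
      (hW.aemeasurable_circumradius _)
  · exact (measurable_const.indicator measurableSet_Iic).comp_aemeasurable
      (hW.aemeasurable_circumradius _)

lemma lintegral_inverseCircumradius_le (hn : 1 ≤ n) (hW : IsBrownianMotion W P) :
    ∫⁻ ω, inverseCircumradius W 1 ω ∂P ≤ ENNReal.ofReal (4 * (1 / (n : ℝ))) := by
  have hn0 : (0 : ℝ) < n := by exact_mod_cast hn
  -- Chosen so that the horizon K h = m + 1 tends to infinity while the overshoot error, of order K
  -- h² = 1 / (m + 1), vanishes.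
  set h : ℕ → ℝ≥0 := fun m => 1 / ((m : ℝ≥0) + 1) ^ 2 with hh
  set K : ℕ → ℕ := fun m => (m + 1) ^ 3 with hK
  have hKh : ∀ m, (K m : ℝ≥0∞) * h m = ((m + 1 : ℕ) : ℝ≥0∞) := by
    intro m
    have : (K m : ℝ≥0) * h m = ((m + 1 : ℕ) : ℝ≥0) := by
      simp only [hK, hh]
      push_cast
      field_simp
    exact_mod_cast congrArg (fun x : ℝ≥0 => (x : ℝ≥0∞)) this
  have hKh2 : ∀ m, (K m : ℝ) * (h m : ℝ) ^ 2 = 1 / ((m : ℝ) + 1) := by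
    intro m
    simp only [hK, hh]
    push_cast
    field_simp
  choose ξ hξ hwalk using fun m => hW.exists_isGaussianStep (h m)
  have hP := (hξ 0).isProbabilityMeasure
  have hA : ∀ m k, MeasurableSet (stays (ξ m) 2 k) := fun m k =>
    (hξ m).past_le k _ (measurableSet_stays (ξ m) 2 k)
  have hpt : ∀ᵐ ω ∂P, inverseCircumradius W 1 ω ≤
      liminf (fun m => occupation (stays (ξ m) 2) (h m) (K m) ω) atTop := by
    filter_upwards [ae_all_iff.2 hwalk] with ω hω
    have h1 : ∀ m : ℕ, min (inverseCircumradius W 1 ω) ((m + 1 : ℕ) : ℝ≥0∞) ≤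
        occupation (stays (ξ m) 2) (h m) (K m) ω := fun m => by
      rw [← hKh m]
      exact min_le_occupation _ fun k hk => inverseCircumradius_le_of_notMem_stays (hω m) hk
    have h2 : Tendsto (fun m : ℕ => min (inverseCircumradius W 1 ω) ((m + 1 : ℕ) : ℝ≥0∞)) atTop
        (𝓝 (min (inverseCircumradius W 1 ω) ⊤)) :=
      tendsto_const_nhds.min (ENNReal.tendsto_nat_nhds_top.comp (tendsto_add_atTop_nat 1))
    rw [min_top_right] at h2
    rw [← h2.liminf_eq]
    exact liminf_le_liminf (Eventually.of_forall h1)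
  refine (lintegral_mono_ae hpt).trans ((lintegral_liminf_le fun m =>
    (lintegral_occupation (P := P) (hA m) (h m) (K m)).1).trans ?_)
  simp_rw [fun m => (lintegral_occupation (P := P) (hA m) (h m) (K m)).2]
  -- The limit in m is taken with ε fixed, because the constant C blows up as ε tends to 0.
  have hε : ∀ ε : ℝ, 0 < ε → liminf (fun m => ENNReal.ofReal
      (h m * ∑ k ∈ Finset.range (K m), P.real (stays (ξ m) 2 k))) atTop ≤
      ENNReal.ofReal ((2 + ε) ^ 2 * (1 / n)) := by
    intro ε hε
    set C := (4 / ε ^ 3 + 1 / ε ^ 2) * ((n : ℝ) ^ 2 * (∫ x, x ^ 4 ∂(gaussianReal 0 1)))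
    have h1 : ∀ m, ENNReal.ofReal (h m * ∑ k ∈ Finset.range (K m), P.real (stays (ξ m) 2 k)) ≤
        ENNReal.ofReal (((2 + ε) ^ 2 + C * (1 / ((m : ℝ) + 1))) * (1 / n)) := by
      intro m
      refine ENNReal.ofReal_le_ofReal ?_
      have h2 := (hξ m).sum_measureReal_stays_le hε (K m)
      rw [hKh2] at h2
      rw [mul_one_div, le_div_iff₀ hn0]
      linarith
    have h2 : Tendsto (fun m : ℕ => ENNReal.ofReal
        (((2 + ε) ^ 2 + C * (1 / ((m : ℝ) + 1))) * (1 / n))) atTop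
        (𝓝 (ENNReal.ofReal (((2 + ε) ^ 2 + C * 0) * (1 / n)))) :=
      ENNReal.tendsto_ofReal ((tendsto_const_nhds.add
        (tendsto_one_div_add_atTop_nhds_zero_nat.const_mul C)).mul_const _)
    rw [mul_zero, add_zero] at h2
    rw [← h2.liminf_eq]
    exact liminf_le_liminf (Eventually.of_forall h1)
  have hlim : Tendsto (fun ε : ℝ => ENNReal.ofReal ((2 + ε) ^ 2 * (1 / n))) (𝓝[>] 0)
      (𝓝 (ENNReal.ofReal (4 * (1 / n)))) := by
    refine ENNReal.tendsto_ofReal (Tendsto.mono_left ?_ nhdsWithin_le_nhds)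
    have hc : Continuous fun ε : ℝ => (2 + ε) ^ 2 * (1 / (n : ℝ)) := by fun_prop
    convert hc.tendsto 0 using 2
    norm_num
  exact ge_of_tendsto hlim (eventually_mem_nhdsWithin.mono fun ε hε' => hε ε hε')

/-- Reverse Fatou needs domination, so the horizon K h = 1000 is fixed; it also gives uniform
continuity of almost every path. -/
lemma le_lintegral_inverseCircumradius (hn : 1 ≤ n) (hW : IsBrownianMotion W P) :
    ENNReal.ofReal (1 / Real.log 2 * (1 / (n : ℝ))) ≤
      ∫⁻ ω, inverseCircumradius W 1 ω ∂P := by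
  have hn1 : (1 : ℝ) ≤ n := by exact_mod_cast hn
  set h : ℕ → ℝ≥0 := fun m => 1 / ((m : ℝ≥0) + 1) with hh
  set K : ℕ → ℕ := fun m => 1000 * (m + 1) with hK
  have hh0 : ∀ m, 0 < h m := fun m => by simp only [hh]; positivity
  have hKh : ∀ m, (K m : ℝ≥0) * h m = 1000 := by
    intro m
    simp only [hK, hh]
    push_cast
    field_simp
  have htend : Tendsto h atTop (𝓝 0) := tendsto_one_div_add_atTop_nhds_zero_nat
  choose ξ hξ hwalk using fun m => hW.exists_isGaussianStep (h m)
  have hP := (hξ 0).isProbabilityMeasure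
  have hA : ∀ m k, MeasurableSet (inside (99 / 100) (ξ m) k) := fun m k =>
    (hξ m).past_le k _ (measurableSet_inside _ (ξ m) k)
  have hpt : ∀ᵐ ω ∂P, limsup (fun m => occupation (inside (99 / 100) (ξ m)) (h m) (K m) ω) atTop ≤
      inverseCircumradius W 1 ω := by
    filter_upwards [ae_all_iff.2 hwalk, hW.ae_continuous] with ω hω hc
    obtain ⟨δ, hδ, hmod⟩ := Metric.uniformContinuousOn_iff.1
      ((isCompact_Icc (a := (0 : ℝ≥0)) (b := 1000)).uniformContinuousOn_of_continuous
        hc.continuousOn) (1 / 300) (by norm_num)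
    have h1 : ∀ᶠ m in atTop, occupation (inside (99 / 100) (ξ m)) (h m) (K m) ω ≤
        inverseCircumradius W 1 ω + h m := by
      have h2 : ∀ᶠ m in atTop, (h m : ℝ) < δ :=
        (NNReal.tendsto_coe.2 htend).eventually_lt_const (by simpa using hδ)
      filter_upwards [h2] with m hm
      refine occupation_le_add fun k hk hin => ?_
      have hkT : k * h m ≤ 1000 := by
        rw [← hKh m]
        gcongr
      have h3 := circumradius_hull_le_one_of_mem_inside (hh0 m) (T := 1000)
        (fun a ha b hb hab => (hmod a ⟨zero_le, ha⟩ b ⟨zero_le, hb⟩ (hab.trans_lt hm)).le)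
        (hω m) hkT hin
      have h5 := le_inverseCircumradius (y := 1) (by simpa using h3)
      rwa [ENNReal.coe_mul, ENNReal.coe_natCast] at h5
    have h4 : Tendsto (fun m => inverseCircumradius W 1 ω + h m) atTop
        (𝓝 (inverseCircumradius W 1 ω + ((0 : ℝ≥0) : ℝ≥0∞))) :=
      tendsto_const_nhds.add (ENNReal.tendsto_coe.2 htend)
    rw [ENNReal.coe_zero, add_zero] at h4
    rw [← h4.limsup_eq]
    exact limsup_le_limsup h1
  refine le_trans ?_ ((limsup_lintegral_le (fun _ => 1000)
    (fun m => (lintegral_occupation (P := P) (hA m) (h m) (K m)).1) (fun m => ?_) ?_).trans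
    (lintegral_mono_ae hpt))
  · simp_rw [fun m => (lintegral_occupation (P := P) (hA m) (h m) (K m)).2]
    refine le_limsup_of_frequently_le (Frequently.of_forall fun m => ?_)
    refine ENNReal.ofReal_le_ofReal ?_
    have h1 := (hξ m).le_sum_measureReal_inside' (s := 99 / 100) (by norm_num) (K m)
    set S := ∑ k ∈ Finset.range (K m), P.real (inside (99 / 100) (ξ m) k)
    have hKh' : (K m : ℝ) * h m = 1000 := by exact_mod_cast hKh m
    rw [hKh'] at h1
    have h2 := mul_le_mul_of_nonneg_right h1 (h m).coe_nonneg
    have h3 : 1000 * ((99 / 100) ^ 2 * (3 / 2)) ≤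
        (n * 1000 + (99 / 100) ^ 2 * (3 / 2)) * (h m * S) := by
      calc (1000 : ℝ) * ((99 / 100) ^ 2 * (3 / 2))
          = K m * ((99 / 100) ^ 2 * (3 / 2)) * h m := by rw [← hKh']; ring
        _ ≤ _ := h2
        _ = _ := by ring
    -- By `h3`, h S is at least 1.47015 · 1000 / (1000 n + 1.47015), which exceeds 1.467 / n for n ≥
    -- 1, so each single m already suffices.
    have hlog : 1 / Real.log 2 ≤ 1.4427 := by
      rw [div_le_iff₀ (Real.log_pos one_lt_two)]
      have := Real.log_two_gt_d9
      linarith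
    refine (mul_le_mul_of_nonneg_right hlog (by positivity)).trans ?_
    rw [mul_one_div, div_le_iff₀ (by linarith)]
    have hx : 0 ≤ (h m : ℝ) * S :=
      mul_nonneg (h m).coe_nonneg (Finset.sum_nonneg fun _ _ => measureReal_nonneg)
    nlinarith [mul_le_mul_of_nonneg_right hn1 hx]
  · filter_upwards with ω
    refine (occupation_le_mul _ _ _ _).trans_eq ?_
    exact_mod_cast congrArg (fun x : ℝ≥0 => (x : ℝ≥0∞)) (hKh m)
  · simp

end IsBrownianMotion

end Brownian

end BrownianHull

theorem theorem6 {Ω : Type*} [MeasurableSpace Ω] (P : Measure Ω) (n : ℕ) (hn : 1 ≤ n)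
    (W : ℝ≥0 → Ω → EuclideanSpace ℝ (Fin n)) (hW : BrownianHull.IsBrownianMotion W P) :
    AEMeasurable (BrownianHull.inverseCircumradius W 1) P ∧
      ENNReal.ofReal (1 / Real.log 2 * (1 / (n : ℝ))) ≤
        ∫⁻ ω, BrownianHull.inverseCircumradius W 1 ω ∂P ∧
      ∫⁻ ω, BrownianHull.inverseCircumradius W 1 ω ∂P ≤ ENNReal.ofReal (4 * (1 / (n : ℝ))) :=
  ⟨hW.aemeasurable_inverseCircumradius 1, hW.le_lintegral_inverseCircumradius hn,
    hW.lintegral_inverseCircumradius_le hn⟩
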